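/- Let $n\ge 1$ and $W^T:\mathbb{R}^n\to\mathbb{C}$, and put $G_\alpha(y)=W^T(y)\,(1+|y|^2)^{-\alpha/2}$ for $\alpha\in\mathbb{R}$. Let $\alpha_{\inf}\in\mathbb{R}$ be such that $G_\beta\in L^1(\mathbb{R}^n)$ for all $\beta>\alpha_{\inf}$ and $G_\beta\notin L^1(\mathbb{R}^n)$ for all $\beta<\alpha_{\inf}$. Let $\alpha\in\mathbb{R}$, $\varepsilon:=\alpha_{\inf}-\alpha$ with $0\le\varepsilon<n$, and assume that $G_\alpha$ has a tail of the form $|y|^{-(n-\varepsilon)}$, that is, $G_\alpha(y)\sim c\,|y|^{-(n-\varepsilon)}$ as $|y|\to\infty$ for some constant $c\neq 0$. Then $G_\alpha$ defines a tempered distribution by $\varphi\mapsto\int G_\alpha\varphi\,dy$ (the integral converging absolutely for every $\varphi\in\mathcal{S}(\mathbb{R}^n)$), and its distributional Fourier transform $\hat G_\alpha$ has the following behavior near $p=0$, where $\langle u(\lambda\,\cdot),\varphi\rangle:=\lambda^{-n}\langle u,\varphi(\cdot/\lambda)\rangle$ for $\lambda>0$. (i) If $\varepsilon>0$, then $\hat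 G_\alpha(p)\sim C|p|^{-\varepsilon}$ near $p=0$ as a distribution: there is a constant $C\neq 0$ such that for every $\varphi\in\mathcal{S}(\mathbb{R}^n)$ $$\lim_{\lambda\to 0^+}\lambda^{\varepsilon}\,\langle\hat G_\alpha(\lambda\,\cdot),\varphi\rangle=C\int_{\mathbb{R}^n}|p|^{-\varepsilon}\varphi(p)\,dp .$$ (ii) If $\varepsilon=0$, that is, $\alpha=\alpha_{\inf}$, the singularity is logarithmic, $\hat G_\alpha(p)\sim -C\log|p|$ near $p=0$ as a distribution: there is a constant $C\neq 0$ such that for every $\varphi\in\mathcal{S}(\mathbb{R}^n)$ $$\lim_{\lambda\to 0^+}\frac{\langle\hat G_\alpha(\lambda\,\cdot),\varphi\rangle}{\log(1/\lambda)}=C\int_{\mathbb{R}^n}\varphi(p)\,dp ,$$ and for every $\varphi\in\mathcal{S}(\mathbb{R}^n)$ with $\int\varphi\,dp=0$ $$\lim_{\lambda\to 0^+}\langle\hat G_\alpha(\lambda\,\cdot),\varphi\rangle=-C\int_{\mathbb{R}^n}\log|p|\;\varphi(p)\,dp .$$ -/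

import Mathlib

open MeasureTheory Filter Asymptotics
open scoped Topology SchwartzMap FourierTransform

noncomputable section

/-- The damped two-point function `G_α(y) = W(y) (1 + |y|²)^(-α/2)`. -/
def dampedG {n : ℕ} (W : EuclideanSpace ℝ (Fin n) → ℂ) (α : ℝ) (y : EuclideanSpace ℝ (Fin n)) : ℂ :=
  W y * (((1 + ‖y‖ ^ 2) ^ (-α / 2) : ℝ) : ℂ)

/-- `a` is the integrability threshold `α_inf` of `W`: `G_α` is in `L¹` for `α > a` and is not in
`L¹` for `α < a`. -/
def IsAlphaInf {n : ℕ} (W : EuclideanSpace ℝ (Fin n) → ℂ) (a : ℝ) : Prop :=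
  (∀ α, a < α → Integrable (dampedG W α)) ∧ (∀ α, α < a → ¬ Integrable (dampedG W α))

/-- `g` has a tail of the form `|y|^(-s)`: `g(y) ~ c |y|^(-s)` as `|y| → ∞`, for some `c ≠ 0`. -/
def HasPowerTail {n : ℕ} (g : EuclideanSpace ℝ (Fin n) → ℂ) (s : ℝ) : Prop :=
  ∃ c : ℂ, c ≠ 0 ∧
    g ~[cocompact (EuclideanSpace ℝ (Fin n))] fun y => c * ((‖y‖ ^ (-s) : ℝ) : ℂ)

/-- The tempered distribution `T` is the one given by the function `g`. -/
def IsRepresentedBy {n : ℕ} (T : 𝓢'(EuclideanSpace ℝ (Fin n), ℂ))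
    (g : EuclideanSpace ℝ (Fin n) → ℂ) : Prop :=
  ∀ φ : 𝓢(EuclideanSpace ℝ (Fin n), ℂ),
    Integrable (fun y => g y * φ y) ∧ T φ = ∫ y, g y * φ y

/-- The Schwartz function `p ↦ φ(p / l)` for `l ≠ 0` (and `0` for `l = 0`, a value never used). -/
def stretch {n : ℕ} (l : ℝ) (φ : 𝓢(EuclideanSpace ℝ (Fin n), ℂ)) :
    𝓢(EuclideanSpace ℝ (Fin n), ℂ) :=
  if h : l ≠ 0 then
    SchwartzMap.compCLMOfContinuousLinearEquiv ℂ
      (ContinuousLinearEquiv.smulLeft (R₁ := ℝ) (M₁ := EuclideanSpace ℝ (Fin n))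
        (Units.mk0 l h)⁻¹) φ
  else 0

theorem stretch_apply {n : ℕ} {l : ℝ} (h : l ≠ 0) (φ : 𝓢(EuclideanSpace ℝ (Fin n), ℂ))
    (p : EuclideanSpace ℝ (Fin n)) : stretch l φ p = φ (l⁻¹ • p) := by
  simp only [stretch, dif_pos h]
  rfl

/-- The rescaled distribution `u(l ·)`, `l > 0`, smeared with `φ`:
`∫ u(l p) φ(p) dp = l^(-n) ∫ u(p) φ(p / l) dp`. -/
def rescaled {n : ℕ} (u : 𝓢'(EuclideanSpace ℝ (Fin n), ℂ)) (l : ℝ)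
    (φ : 𝓢(EuclideanSpace ℝ (Fin n), ℂ)) : ℂ :=
  (((l ^ n)⁻¹ : ℝ) : ℂ) * u (stretch l φ)

/-- `u(p) ~ C |p|^(-ε)` near `p = 0` in the sense of distributions, with `C ≠ 0`:
`l^ε u(l p) → C |p|^(-ε)` as `l → 0+`, smeared with any test function. -/
def HasPowerSingularity {n : ℕ} (u : 𝓢'(EuclideanSpace ℝ (Fin n), ℂ)) (ε : ℝ) : Prop :=
  ∃ C : ℂ, C ≠ 0 ∧ ∀ φ : 𝓢(EuclideanSpace ℝ (Fin n), ℂ),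
    Tendsto (fun l : ℝ => ((l ^ ε : ℝ) : ℂ) * rescaled u l φ) (𝓝[>] 0)
      (𝓝 (C * ∫ p, ((‖p‖ ^ (-ε) : ℝ) : ℂ) * φ p))

/-- `u(p) ~ -C log |p|` near `p = 0` in the sense of distributions, with `C ≠ 0`:
as `l → 0+`, `u(l p) / log (1 / l) → C` smeared with any test function, and
`u(l p) → -C log |p|` modulo constants, that is, smeared with any test function of integral `0`. -/
def HasLogSingularity {n : ℕ} (u : 𝓢'(EuclideanSpace ℝ (Fin n), ℂ)) : Prop :=
  ∃ C : ℂ, C ≠ 0 ∧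
    (∀ φ : 𝓢(EuclideanSpace ℝ (Fin n), ℂ),
      Tendsto (fun l : ℝ => rescaled u l φ / ((Real.log (1 / l) : ℝ) : ℂ)) (𝓝[>] 0)
        (𝓝 (C * ∫ p, φ p))) ∧
    (∀ φ : 𝓢(EuclideanSpace ℝ (Fin n), ℂ), (∫ p, φ p) = 0 →
      Tendsto (fun l : ℝ => rescaled u l φ) (𝓝[>] 0)
        (𝓝 (-C * ∫ p, ((Real.log ‖p‖ : ℝ) : ℂ) * φ p)))

end

/-!
If `T` is given by the function `G`, then `⟨T̂(λ·), φ⟩ = ∫ G(y) φ̂(λ y) dy`. Substituting `x = λ y`,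
only the tail `c |y|^(-(n-ε))` of `G` survives as `λ → 0`, and `λ^ε ⟨T̂(λ·), φ⟩` tends to
`c ∫ |x|^(-(n-ε)) φ̂(x) dx`. A pairing with a power of `|x|` is the Mellin transform of the pairing
with the Gaussians `exp(-π |x|² t)`, and passing from `φ̂` to `φ` inverts `t` there, up to a power
of `t`; comparing the two Mellin transforms gives Riesz' formula, a multiple of
`∫ |p|^(-ε) φ(p) dp`.

For `ε = 0` and `∫ φ = 0` the Mellin transform on the side of `φ` is taken at `0`, where the
integrals in `t` are Frullani integrals and produce `-log |p|`. For general `φ` one removes the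
value `φ̂(0)` on the unit ball, whose contribution is `φ̂(0)` times the integral of `G` over the
ball of radius `1 / λ`, and this grows like `c |Sⁿ⁻¹| log (1 / λ)`.
-/

open Module

section Integrability

variable {E F : Type*} [NormedAddCommGroup E] [NormedSpace ℝ E] [FiniteDimensional ℝ E]
  [MeasurableSpace E] [BorelSpace E] {μ : Measure E} [μ.IsAddHaarMeasure] [NormedAddCommGroup F]

theorem integrable_of_norm_le_rpow_of_norm_le [Nontrivial E] {f : E → F} {g : E → ℝ} {K a : ℝ}
    (hf : AEStronglyMeasurable f μ) (hg : Integrable g μ) (ha : a < finrank ℝ E)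
    (hnear : ∀ x, 0 < ‖x‖ → ‖x‖ < 1 → ‖f x‖ ≤ K * ‖x‖ ^ (-a))
    (hfar : ∀ x, 1 ≤ ‖x‖ → ‖f x‖ ≤ g x) : Integrable f μ := by
  rw [← integrableOn_univ, ← Set.union_compl_self (Metric.ball (0 : E) 1)]
  refine IntegrableOn.union ?_ ?_
  · refine integrableOn_ball_of_norm_le_rpow (C := K) (finrank_pos (R := ℝ) (M := E)) ha ?_ hf
    filter_upwards [ae_restrict_mem measurableSet_ball, ae_restrict_of_ae (μ.ae_ne 0)] with x hx hx0
    exact hnear x (norm_pos_iff.2 hx0) (mem_ball_zero_iff.1 hx)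
  · refine hg.integrableOn.mono' hf.restrict ?_
    filter_upwards [ae_restrict_mem measurableSet_ball.compl] with x hx
    exact hfar x (by simpa using hx)

theorem integrable_norm_rpow_mul [Nontrivial E] {f : E → ℂ} {K δ s : ℝ} (hf : Integrable f μ)
    (hnear : ∀ x, ‖f x‖ ≤ K * ‖x‖ ^ δ) (hs : 0 ≤ s) (hsδ : s < finrank ℝ E + δ) :
    Integrable (fun x => ((‖x‖ ^ (-s) : ℝ) : ℂ) * f x) μ := by
  have norm_eq (x : E) : ‖((‖x‖ ^ (-s) : ℝ) : ℂ) * f x‖ = ‖x‖ ^ (-s) * ‖f x‖ := by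
    rw [norm_mul, Complex.norm_of_nonneg (by positivity)]
  refine integrable_of_norm_le_rpow_of_norm_le (K := K) (a := s - δ)
    (AEStronglyMeasurable.mul (Measurable.aestronglyMeasurable (by fun_prop))
      hf.aestronglyMeasurable) hf.norm (by linarith) (fun x hx _ => ?_) fun x hx => ?_
  · calc ‖((‖x‖ ^ (-s) : ℝ) : ℂ) * f x‖ ≤ ‖x‖ ^ (-s) * (K * ‖x‖ ^ δ) := by
          rw [norm_eq]; gcongr; exact hnear x
      _ = K * ‖x‖ ^ (-(s - δ)) := by
          rw [mul_left_comm, ← Real.rpow_add hx, neg_sub, neg_add_eq_sub]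
  · rw [norm_eq]
    exact mul_le_of_le_one_left (norm_nonneg _)
      (Real.rpow_le_one_of_one_le_of_nonpos hx (neg_nonpos.2 hs))

theorem integrable_log_norm_mul [Nontrivial E] {f : E → ℂ} {K : ℝ}
    (hf : AEStronglyMeasurable f μ) (hbdd : ∀ x, ‖f x‖ ≤ K)
    (hmoment : Integrable (fun x => ‖x‖ * ‖f x‖) μ) :
    Integrable (fun x => ((Real.log ‖x‖ : ℝ) : ℂ) * f x) μ := by
  have hdim : (1 : ℝ) ≤ finrank ℝ E := by exact_mod_cast finrank_pos (R := ℝ) (M := E)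
  refine integrable_of_norm_le_rpow_of_norm_le (K := 2 * K) (a := 1 / 2)
    (AEStronglyMeasurable.mul (Measurable.aestronglyMeasurable (by fun_prop)) hf) hmoment
    (by linarith) (fun x hx hx1 => ?_) fun x hx => ?_
  · have hlog : |Real.log ‖x‖| ≤ 2 * ‖x‖ ^ (-(1 / 2 : ℝ)) := by
      have h := (Real.abs_log_mul_self_rpow_lt ‖x‖ (1 / 2) hx hx1.le (by norm_num)).le
      rw [abs_mul, abs_of_nonneg (Real.rpow_nonneg hx.le _), ← le_div_iff₀ (by positivity)] at h
      rwa [one_div_one_div, div_eq_mul_inv, ← Real.rpow_neg hx.le] at h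
    calc ‖((Real.log ‖x‖ : ℝ) : ℂ) * f x‖ = |Real.log ‖x‖| * ‖f x‖ := by
          rw [norm_mul, Complex.norm_real, Real.norm_eq_abs]
      _ ≤ 2 * ‖x‖ ^ (-(1 / 2 : ℝ)) * K := by gcongr; exact hbdd x
      _ = 2 * K * ‖x‖ ^ (-(1 / 2 : ℝ)) := by ring
  · rw [norm_mul, Complex.norm_of_nonneg (Real.log_nonneg hx)]
    gcongr
    exact Real.log_le_self (norm_nonneg x)

end Integrability

theorem integral_integral_ofReal_mul {X Y : Type*} [MeasurableSpace X] [MeasurableSpace Y]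
    {μ : Measure X} {ν : Measure Y} [SFinite μ] [SFinite ν] {k : X → Y → ℝ} {m : X → ℝ}
    {f : X → ℂ} (hk : AEStronglyMeasurable (Function.uncurry k) (μ.prod ν))
    (hf : AEStronglyMeasurable f μ) (hsign : ∀ x, 0 ≤ᵐ[ν] k x ∨ k x ≤ᵐ[ν] 0)
    (hint : ∀ᵐ x ∂μ, Integrable (k x) ν) (hm : ∀ᵐ x ∂μ, ∫ y, k x y ∂ν = m x)
    (hmf : Integrable (fun x => (m x : ℂ) * f x) μ) :
    ∫ y, ∫ x, (k x y : ℂ) * f x ∂μ ∂ν = ∫ x, (m x : ℂ) * f x ∂μ := by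
  have integral_abs (x : X) : ∫ y, |k x y| ∂ν = |∫ y, k x y ∂ν| := by
    rcases hsign x with h | h
    · rw [abs_of_nonneg (integral_nonneg_of_ae h)]
      exact integral_congr_ae (h.mono fun y hy => abs_of_nonneg hy)
    · rw [abs_of_nonpos (integral_nonpos_of_ae h), ← integral_neg]
      exact integral_congr_ae (h.mono fun y hy => abs_of_nonpos hy)
  have hmeas : AEStronglyMeasurable (Function.uncurry fun x y => (k x y : ℂ) * f x) (μ.prod ν) :=
    (Complex.continuous_ofReal.comp_aestronglyMeasurable hk).mul hf.comp_fst
  have hprod : Integrable (Function.uncurry fun x y => (k x y : ℂ) * f x) (μ.prod ν) := by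
    refine (integrable_prod_iff hmeas).2 ⟨?_, ?_⟩
    · filter_upwards [hint] with x hx using hx.ofReal.mul_const (f x)
    · refine hmf.norm.congr ?_
      filter_upwards [hm] with x hx
      simp only [Function.uncurry_apply_pair, norm_mul, Complex.norm_real, Real.norm_eq_abs]
      rw [integral_mul_const, integral_abs, hx]
  rw [← integral_integral_swap hprod]
  refine integral_congr_ae ?_
  filter_upwards [hm] with x hx
  rw [integral_mul_const, integral_complex_ofReal, hx]

theorem integrableOn_ball_of_locallyIntegrable {X F : Type*} [PseudoMetricSpace X] [ProperSpace X]
    [MeasurableSpace X] {μ : Measure X} [NormedAddCommGroup F] {f : X → F}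
    (hf : LocallyIntegrable f μ) (x : X) (r : ℝ) : IntegrableOn f (Metric.ball x r) μ :=
  (hf.integrableOn_isCompact (isCompact_closedBall x r)).mono_set Metric.ball_subset_closedBall

theorem gammaℝ_ofReal (a : ℝ) :
    Complex.Gammaℝ a = ((Real.pi ^ (-a / 2) * Real.Gamma (a / 2) : ℝ) : ℂ) := by
  rw [Complex.Gammaℝ_def, Complex.ofReal_mul, Complex.ofReal_cpow Real.pi_pos.le,
    ← Complex.Gamma_ofReal]
  push_cast
  rfl

theorem integral_rpow_mul_exp_neg_pi_mul_norm_sq {E : Type*} [NormedAddCommGroup E] {a : ℝ}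
    (ha : 0 < a) {x : E} (hx : x ≠ 0) :
    ∫ t in Set.Ioi (0 : ℝ), t ^ (a / 2 - 1) * Real.exp (-(Real.pi * ‖x‖ ^ 2 * t)) =
      Real.pi ^ (-a / 2) * Real.Gamma (a / 2) * ‖x‖ ^ (-a) := by
  have hx0 := norm_pos_iff.2 hx
  have hpi := Real.pi_pos
  have norm_sq_rpow : (‖x‖ ^ 2) ^ (-(a / 2)) = ‖x‖ ^ (-a) := by
    rw [← Real.rpow_natCast, ← Real.rpow_mul hx0.le]
    congr 1
    push_cast
    ring
  rw [Real.integral_rpow_mul_exp_neg_mul_Ioi (half_pos ha) (by positivity), one_div,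
    ← Real.rpow_neg_eq_inv_rpow, Real.mul_rpow hpi.le (by positivity), norm_sq_rpow, neg_div]
  ring

theorem integrableOn_inv_mul_exp_neg_sub_exp_neg {a b : ℝ} (ha : 0 < a) (hb : 0 < b) :
    IntegrableOn (fun t : ℝ => t⁻¹ * (Real.exp (-(a * t)) - Real.exp (-(b * t)))) (Set.Ioi 0) := by
  wlog hab : a ≤ b generalizing a b
  · refine (this hb ha (not_le.1 hab).le).neg.congr (ae_of_all _ fun t => ?_)
    simp only [Pi.neg_apply, ← mul_neg, neg_sub]
  have hexp : IntegrableOn (fun t : ℝ => Real.exp (-(a * t))) (Set.Ioi 0) := by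
    simpa only [neg_mul] using exp_neg_integrableOn_Ioi 0 ha
  refine (hexp.const_mul (b - a)).mono'
    (Measurable.aestronglyMeasurable (by fun_prop)) ?_
  filter_upwards [ae_restrict_mem measurableSet_Ioi] with t (ht : 0 < t)
  have hle : Real.exp (-(b * t)) ≤ Real.exp (-(a * t)) := by gcongr
  have hfactor : Real.exp (-(b * t)) = Real.exp (-(a * t)) * Real.exp (-((b - a) * t)) := by
    rw [← Real.exp_add]; congr 1; ring
  have hone : 1 - Real.exp (-((b - a) * t)) ≤ (b - a) * t := by
    linarith [Real.add_one_le_exp (-((b - a) * t))]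
  rw [Real.norm_of_nonneg (mul_nonneg (inv_nonneg.2 ht.le) (sub_nonneg.2 hle)),
    inv_mul_le_iff₀ ht, hfactor]
  nlinarith [mul_le_mul_of_nonneg_left hone (Real.exp_pos (-(a * t))).le]

theorem integral_inv_mul_exp_neg_sub_exp_neg {a b : ℝ} (ha : 0 < a) (hb : 0 < b) :
    ∫ t in Set.Ioi (0 : ℝ), t⁻¹ * (Real.exp (-(a * t)) - Real.exp (-(b * t))) =
      Real.log (b / a) := by
  have hcont : Continuous fun t : ℝ => Real.exp (-t) := by fun_prop
  have hzero : Tendsto (fun t : ℝ => Real.exp (-t)) (𝓝[>] 0) (𝓝 1) := by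
    simpa using (hcont.tendsto 0).mono_left nhdsWithin_le_nhds
  have h := Frullani.integral_Ioi_eq (hcont.locallyIntegrable.locallyIntegrableOn _) ha hb hzero
    Real.tendsto_exp_neg_atTop_nhds_zero (integrableOn_inv_mul_exp_neg_sub_exp_neg ha hb)
  simpa using h

/-- The pairing `t ↦ ∫ exp (-π ‖x‖² t) f x dx` of `f` with the Gaussians. Pairings of `f` with
powers of `‖x‖` are Mellin transforms of it. -/
noncomputable def gaussianPairing {E : Type*} [NormedAddCommGroup E] [InnerProductSpace ℝ E]
    [FiniteDimensional ℝ E] [MeasurableSpace E] [BorelSpace E] (f : E → ℂ) (t : ℝ) : ℂ :=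
  ∫ x, ((Real.exp (-(Real.pi * ‖x‖ ^ 2 * t)) : ℝ) : ℂ) * f x

section GaussianPairing

variable {E : Type*} [NormedAddCommGroup E] [InnerProductSpace ℝ E] [FiniteDimensional ℝ E]
  [MeasurableSpace E] [BorelSpace E] {f : E → ℂ}

theorem gaussianPairing_fourier (hf : Integrable f) {t : ℝ} (ht : 0 < t) :
    gaussianPairing (𝓕 f) t = (t : ℂ) ^ (-(finrank ℝ E / 2 : ℂ)) * gaussianPairing f t⁻¹ := by
  have hb : 0 < ((Real.pi * t : ℝ) : ℂ).re := by
    rw [Complex.ofReal_re]; exact mul_pos Real.pi_pos ht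
  have hgauss : Integrable fun x : E => Complex.exp (-((Real.pi * t : ℝ) : ℂ) * ‖x‖ ^ 2) := by
    simpa using GaussianFourier.integrable_cexp_neg_mul_sq_norm_add hb 0 (0 : E)
  have fourier_gauss (p : E) :
      𝓕 (fun x : E => Complex.exp (-((Real.pi * t : ℝ) : ℂ) * ‖x‖ ^ 2)) p =
        (t : ℂ) ^ (-(finrank ℝ E / 2 : ℂ)) *
          ((Real.exp (-(Real.pi * ‖p‖ ^ 2 * t⁻¹)) : ℝ) : ℂ) := by
    have hpi : (Real.pi : ℂ) ≠ 0 := Complex.ofReal_ne_zero.2 Real.pi_ne_zero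
    have ht0 : (t : ℂ) ≠ 0 := Complex.ofReal_ne_zero.2 ht.ne'
    rw [fourier_gaussian_innerProductSpace hb, Complex.cpow_neg,
      ← Complex.inv_cpow _ _ (Complex.arg_ofReal_of_nonneg ht.le ▸ Real.pi_ne_zero.symm)]
    congr 1 <;> push_cast <;> congr 1 <;> field_simp
  have hflip := VectorFourier.integral_fourierIntegral_smul_eq_flip (L := innerₗ E)
    Real.continuous_fourierChar continuous_inner hgauss hf
  calc gaussianPairing (𝓕 f) t
      = ∫ x, Complex.exp (-((Real.pi * t : ℝ) : ℂ) * ‖x‖ ^ 2) • 𝓕 f x := by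
        refine integral_congr_ae (ae_of_all _ fun x => ?_)
        simp only [smul_eq_mul]
        push_cast
        ring_nf
    _ = ∫ p, 𝓕 (fun x : E => Complex.exp (-((Real.pi * t : ℝ) : ℂ) * ‖x‖ ^ 2)) p • f p := by
        rw [flip_innerₗ] at hflip
        exact hflip.symm
    _ = (t : ℂ) ^ (-(finrank ℝ E / 2 : ℂ)) * gaussianPairing f t⁻¹ := by
        simp only [fourier_gauss, smul_eq_mul, mul_assoc, integral_const_mul, gaussianPairing]

theorem mellin_gaussianPairing_fourier (hf : Integrable f) (s : ℂ) :
    mellin (gaussianPairing (𝓕 f)) s = mellin (gaussianPairing f) (finrank ℝ E / 2 - s) := by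
  calc mellin (gaussianPairing (𝓕 f)) s
      = mellin (fun t : ℝ =>
          (t : ℂ) ^ (-(finrank ℝ E / 2 : ℂ)) • gaussianPairing f t⁻¹) s :=
        setIntegral_congr_fun measurableSet_Ioi fun t ht => by
          simp only [gaussianPairing_fourier hf ht, smul_eq_mul]
    _ = mellin (gaussianPairing f) (finrank ℝ E / 2 - s) := by
        rw [mellin_cpow_smul, mellin_comp_inv, neg_add_rev, neg_neg, sub_eq_add_neg]

theorem mellin_gaussianPairing [Nontrivial E] (hf : AEStronglyMeasurable f) {a : ℝ} (ha : 0 < a)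
    (hfa : Integrable fun x => ((‖x‖ ^ (-a) : ℝ) : ℂ) * f x) :
    mellin (gaussianPairing f) (a / 2) =
      Complex.Gammaℝ a * ∫ x, ((‖x‖ ^ (-a) : ℝ) : ℂ) * f x := by
  set γ : ℝ := Real.pi ^ (-a / 2) * Real.Gamma (a / 2) with hγ
  have hγpos : 0 < γ :=
    mul_pos (Real.rpow_pos_of_pos Real.pi_pos _) (Real.Gamma_pos_of_pos (half_pos ha))
  set k : E → ℝ → ℝ := fun x t => t ^ (a / 2 - 1) * Real.exp (-(Real.pi * ‖x‖ ^ 2 * t)) with hk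
  have integral_k {x : E} (hx : x ≠ 0) : ∫ t in Set.Ioi (0 : ℝ), k x t = γ * ‖x‖ ^ (-a) :=
    integral_rpow_mul_exp_neg_pi_mul_norm_sq ha hx
  have integrable_k {x : E} (hx : x ≠ 0) : IntegrableOn (k x) (Set.Ioi 0) := by
    refine Integrable.of_integral_ne_zero ?_
    rw [integral_k hx]
    exact (mul_pos hγpos (Real.rpow_pos_of_pos (norm_pos_iff.2 hx) _)).ne'
  calc mellin (gaussianPairing f) (a / 2)
      = ∫ t in Set.Ioi (0 : ℝ), ∫ x, (k x t : ℂ) * f x := by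
        refine setIntegral_congr_fun measurableSet_Ioi fun t (ht : 0 < t) => ?_
        simp only [gaussianPairing, smul_eq_mul, ← integral_const_mul, hk, Complex.ofReal_mul,
          Complex.ofReal_cpow ht.le, mul_assoc]
        push_cast
        rfl
    _ = ∫ x, ((γ * ‖x‖ ^ (-a) : ℝ) : ℂ) * f x := by
        refine integral_integral_ofReal_mul (Measurable.aestronglyMeasurable (by fun_prop)) hf
          (fun x => Or.inl ?_) ((Measure.ae_ne volume 0).mono fun x => integrable_k)
          ((Measure.ae_ne volume 0).mono fun x => integral_k) ?_
        · filter_upwards [ae_restrict_mem measurableSet_Ioi] with t (ht : 0 < t)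
          exact mul_nonneg (Real.rpow_nonneg ht.le _) (Real.exp_pos _).le
        · simpa only [Complex.ofReal_mul, mul_assoc] using hfa.const_mul (γ : ℂ)
    _ = Complex.Gammaℝ a * ∫ x, ((‖x‖ ^ (-a) : ℝ) : ℂ) * f x := by
        simp only [gammaℝ_ofReal, ← hγ, Complex.ofReal_mul, mul_assoc, integral_const_mul]

theorem gaussianPairing_eq_of_integral_eq_zero (hf : Integrable f) (hf0 : ∫ x, f x = 0) {t : ℝ}
    (ht : 0 ≤ t) :
    gaussianPairing f t = ∫ x,
      ((Real.exp (-(Real.pi * ‖x‖ ^ 2 * t)) - Real.exp (-(Real.pi * t)) : ℝ) : ℂ) * f x := by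
  have hgauss : Integrable fun x => ((Real.exp (-(Real.pi * ‖x‖ ^ 2 * t)) : ℝ) : ℂ) * f x := by
    refine hf.bdd_mul (c := 1) (Continuous.aestronglyMeasurable (by fun_prop))
      (ae_of_all _ fun x => ?_)
    rw [Complex.norm_of_nonneg (Real.exp_pos _).le, Real.exp_le_one_iff, neg_nonpos]
    positivity
  simp only [Complex.ofReal_sub, sub_mul]
  rw [integral_sub hgauss (hf.const_mul _), integral_const_mul, hf0, mul_zero, sub_zero,
    gaussianPairing]

theorem mellin_gaussianPairing_zero [Nontrivial E] (hf : Integrable f) (hf0 : ∫ x, f x = 0)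
    (hlog : Integrable fun x => ((Real.log ‖x‖ : ℝ) : ℂ) * f x) :
    mellin (gaussianPairing f) 0 = -2 * ∫ x, ((Real.log ‖x‖ : ℝ) : ℂ) * f x := by
  set k : E → ℝ → ℝ := fun x t =>
    t⁻¹ * (Real.exp (-(Real.pi * ‖x‖ ^ 2 * t)) - Real.exp (-(Real.pi * t))) with hk
  have hπ (x : E) (hx : x ≠ 0) : 0 < Real.pi * ‖x‖ ^ 2 := by
    have := norm_pos_iff.2 hx
    positivity
  have integral_k (x : E) (hx : x ≠ 0) :
      ∫ t in Set.Ioi (0 : ℝ), k x t = -2 * Real.log ‖x‖ := by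
    rw [hk, integral_inv_mul_exp_neg_sub_exp_neg (hπ x hx) Real.pi_pos,
      div_mul_cancel_left₀ Real.pi_ne_zero, Real.log_inv, Real.log_pow]
    push_cast
    ring
  have k_sign (x : E) : 0 ≤ᵐ[volume.restrict (Set.Ioi 0)] k x ∨
      k x ≤ᵐ[volume.restrict (Set.Ioi 0)] 0 := by
    rcases le_total (Real.pi * ‖x‖ ^ 2) Real.pi with h | h
    · left
      filter_upwards [ae_restrict_mem measurableSet_Ioi] with t (ht : 0 < t)
      exact mul_nonneg (inv_nonneg.2 ht.le) (sub_nonneg.2 (by gcongr))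
    · right
      filter_upwards [ae_restrict_mem measurableSet_Ioi] with t (ht : 0 < t)
      exact mul_nonpos_of_nonneg_of_nonpos (inv_nonneg.2 ht.le) (sub_nonpos.2 (by gcongr))
  calc mellin (gaussianPairing f) 0
      = ∫ t in Set.Ioi (0 : ℝ), ∫ x, (k x t : ℂ) * f x := by
        refine setIntegral_congr_fun measurableSet_Ioi fun t (ht : 0 < t) => ?_
        simp only [gaussianPairing_eq_of_integral_eq_zero hf hf0 ht.le, hk, zero_sub,
          Complex.cpow_neg_one, smul_eq_mul, Complex.ofReal_mul, Complex.ofReal_inv, mul_assoc,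
          integral_const_mul]
    _ = ∫ x, ((-2 * Real.log ‖x‖ : ℝ) : ℂ) * f x := by
        refine integral_integral_ofReal_mul (Measurable.aestronglyMeasurable (by fun_prop))
          hf.aestronglyMeasurable k_sign ((Measure.ae_ne volume 0).mono fun x hx =>
            integrableOn_inv_mul_exp_neg_sub_exp_neg (hπ x hx) Real.pi_pos)
          ((Measure.ae_ne volume 0).mono integral_k) ?_
        simpa only [Complex.ofReal_mul, mul_assoc] using hlog.const_mul ((-2 : ℝ) : ℂ)
    _ = -2 * ∫ x, ((Real.log ‖x‖ : ℝ) : ℂ) * f x := by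
        simp only [Complex.ofReal_mul, mul_assoc, integral_const_mul]
        push_cast
        rfl

theorem integral_norm_rpow_mul_fourier [Nontrivial E] {a b : ℝ} (ha : 0 < a) (hb : 0 < b)
    (hab : a + b = finrank ℝ E) (hf : Integrable f) (hfourier : AEStronglyMeasurable (𝓕 f))
    (hfa : Integrable fun x => ((‖x‖ ^ (-a) : ℝ) : ℂ) * 𝓕 f x)
    (hfb : Integrable fun x => ((‖x‖ ^ (-b) : ℝ) : ℂ) * f x) :
    Complex.Gammaℝ a * ∫ x, ((‖x‖ ^ (-a) : ℝ) : ℂ) * 𝓕 f x =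
      Complex.Gammaℝ b * ∫ p, ((‖p‖ ^ (-b) : ℝ) : ℂ) * f p := by
  have hab' : (finrank ℝ E / 2 - a / 2 : ℂ) = b / 2 := by
    rw [← Complex.ofReal_natCast, ← hab]; push_cast; ring
  rw [← mellin_gaussianPairing hfourier ha hfa, mellin_gaussianPairing_fourier hf, hab',
    mellin_gaussianPairing hf.aestronglyMeasurable hb hfb]

theorem integral_norm_rpow_neg_finrank_mul_fourier [Nontrivial E] (hf : Integrable f)
    (hf0 : ∫ x, f x = 0) (hfourier : AEStronglyMeasurable (𝓕 f))
    (hfd : Integrable fun x => ((‖x‖ ^ (-finrank ℝ E : ℝ) : ℝ) : ℂ) * 𝓕 f x)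
    (hlog : Integrable fun x => ((Real.log ‖x‖ : ℝ) : ℂ) * f x) :
    Complex.Gammaℝ (finrank ℝ E) * ∫ x, ((‖x‖ ^ (-finrank ℝ E : ℝ) : ℝ) : ℂ) * 𝓕 f x =
      -2 * ∫ p, ((Real.log ‖p‖ : ℝ) : ℂ) * f p := by
  have hd : (0 : ℝ) < finrank ℝ E := by exact_mod_cast finrank_pos (R := ℝ) (M := E)
  have h := mellin_gaussianPairing hfourier hd hfd
  rw [mellin_gaussianPairing_fourier hf, Complex.ofReal_natCast, sub_self] at h
  rw [← h, mellin_gaussianPairing_zero hf hf0 hlog]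

theorem gammaℝ_finrank_mul_volume_ball [Nontrivial E] :
    Complex.Gammaℝ (finrank ℝ E) *
      ((finrank ℝ E * volume.real (Metric.ball (0 : E) 1) : ℝ) : ℂ) = 2 := by
  have hd : (0 : ℝ) < finrank ℝ E := by exact_mod_cast finrank_pos (R := ℝ) (M := E)
  have hpi := Real.pi_pos
  have hsqrt : Real.sqrt Real.pi ^ finrank ℝ E = Real.pi ^ ((finrank ℝ E : ℝ) / 2) := by
    rw [Real.sqrt_eq_rpow, ← Real.rpow_natCast, ← Real.rpow_mul hpi.le]
    ring_nf
  have hΓ := (Real.Gamma_pos_of_pos (half_pos hd)).ne'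
  rw [← Complex.ofReal_natCast, gammaℝ_ofReal, ← Complex.ofReal_mul, Measure.real,
    InnerProductSpace.volume_ball, ENNReal.ofReal_one, one_pow, one_mul, hsqrt,
    Real.Gamma_add_one (half_pos hd).ne', ENNReal.toReal_ofReal (by positivity), neg_div,
    Real.rpow_neg hpi.le, ← Complex.ofReal_ofNat, Complex.ofReal_inj]
  field_simp [hΓ]

end GaussianPairing

theorem tendsto_rpow_mul_setIntegral_ball_comp_smul {E : Type*} [NormedAddCommGroup E]
    [NormedSpace ℝ E] [MeasurableSpace E] [OpensMeasurableSpace E] {μ : Measure E} {G h : E → ℂ}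
    {K R a δ : ℝ} (hR : 0 ≤ R) (hG : IntegrableOn G (Metric.ball 0 R) μ)
    (hh : ∀ x, ‖h x‖ ≤ K * ‖x‖ ^ δ) (hδ : 0 ≤ δ) (haδ : 0 < a + δ) :
    Tendsto (fun l : ℝ => ((l ^ a : ℝ) : ℂ) * ∫ y in Metric.ball 0 R, G y * h (l • y) ∂μ)
      (𝓝[>] 0) (𝓝 0) := by
  set I := ∫ y in Metric.ball 0 R, ‖G y‖ ∂μ
  have hpow : Tendsto (fun l : ℝ => l ^ (a + δ) * (|K| * R ^ δ * I)) (𝓝[>] 0)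
      (𝓝 0) := by
    have := (Real.continuousAt_rpow_const 0 _ (Or.inr haδ.le)).tendsto.mono_left
      (nhdsWithin_le_nhds (s := Set.Ioi 0))
    simpa [Real.zero_rpow haδ.ne'] using this.mul_const (|K| * R ^ δ * I)
  refine squeeze_zero_norm' ?_ hpow
  filter_upwards [self_mem_nhdsWithin] with l (hl : 0 < l)
  have hinner : ‖∫ y in Metric.ball 0 R, G y * h (l • y) ∂μ‖ ≤ |K| * (l * R) ^ δ * I := by
    rw [← integral_const_mul]
    refine norm_integral_le_of_norm_le (hG.norm.const_mul _) ?_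
    filter_upwards [ae_restrict_mem measurableSet_ball] with y hy
    have hnorm : ‖l • y‖ ≤ l * R := by
      rw [norm_smul, Real.norm_of_nonneg hl.le]
      gcongr
      exact (mem_ball_zero_iff.1 hy).le
    rw [norm_mul, mul_comm]
    gcongr
    calc ‖h (l • y)‖ ≤ K * ‖l • y‖ ^ δ := hh _
      _ ≤ |K| * (l * R) ^ δ := by gcongr; exact le_abs_self K
  calc ‖((l ^ a : ℝ) : ℂ) * ∫ y in Metric.ball 0 R, G y * h (l • y) ∂μ‖
      ≤ l ^ a * (|K| * (l * R) ^ δ * I) := by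
        rw [norm_mul, Complex.norm_of_nonneg (by positivity)]
        gcongr
    _ = l ^ (a + δ) * (|K| * R ^ δ * I) := by
        rw [Real.mul_rpow hl.le hR, Real.rpow_add hl]
        ring

section Growth

variable {E : Type*} [NormedAddCommGroup E] {G : E → ℂ} {c : ℂ} {s : ℝ}

theorem isBigO_rpow_of_isEquivalent
    (hG : G ~[cocompact E] fun y => c * ((‖y‖ ^ (-s) : ℝ) : ℂ)) :
    G =O[cocompact E] fun y => ‖y‖ ^ (-s) :=
  hG.isBigO.trans ((Complex.isBigO_ofReal_left.2 (isBigO_refl _ _)).const_mul_left c)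

variable [ProperSpace E]

theorem exists_norm_le_mul_of_isBigO {g : E → ℝ} (hG : G =O[cocompact E] g) :
    ∃ M R : ℝ, 0 ≤ M ∧ 0 ≤ R ∧ ∀ y, R ≤ ‖y‖ → ‖G y‖ ≤ M * ‖g y‖ := by
  obtain ⟨M, hM, hbound⟩ := hG.exists_nonneg
  rw [IsBigOWith, ← Metric.cobounded_eq_cocompact, hasBasis_cobounded_norm.eventually_iff] at hbound
  obtain ⟨R, -, hR⟩ := hbound
  exact ⟨M, max R 0, hM, le_max_right _ _, fun y hy => hR ((le_max_left R 0).trans hy)⟩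

theorem isBigO_one_of_isEquivalent
    (hG : G ~[cocompact E] fun y => c * ((‖y‖ ^ (-s) : ℝ) : ℂ)) (hs : 0 ≤ s) :
    G =O[cocompact E] (fun _ => 1 : E → ℝ) := by
  refine (isBigO_rpow_of_isEquivalent hG).trans (IsBigO.of_bound 1 ?_)
  rw [← Metric.cobounded_eq_cocompact]
  filter_upwards [eventually_cobounded_le_norm 1] with y hy
  rw [Real.norm_of_nonneg (by positivity), norm_one, mul_one]
  exact Real.rpow_le_one_of_one_le_of_nonpos hy (neg_nonpos.2 hs)

end Growth

theorem rpow_mul_norm_inv_smul_rpow {E : Type*} [NormedAddCommGroup E] [NormedSpace ℝ E]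
    {l s : ℝ} (hl : 0 < l) (x : E) :
    l ^ (-s) * ‖l⁻¹ • x‖ ^ (-s) = ‖x‖ ^ (-s) := by
  rw [norm_smul, norm_inv, Real.norm_of_nonneg hl.le, ← Real.mul_rpow hl.le (by positivity),
    mul_inv_cancel_left₀ hl.ne']

section Scaling

variable {E : Type*} [NormedAddCommGroup E] [NormedSpace ℝ E] [FiniteDimensional ℝ E]
  {G h : E → ℂ} {c : ℂ} {s : ℝ}

theorem tendsto_rpow_mul_comp_inv_smul
    (hG : G ~[cocompact E] fun y => c * ((‖y‖ ^ (-s) : ℝ) : ℂ)) {x : E} (hx : x ≠ 0) :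
    Tendsto (fun l : ℝ => ((l ^ (-s) : ℝ) : ℂ) * G (l⁻¹ • x)) (𝓝[>] 0)
      (𝓝 (c * ((‖x‖ ^ (-s) : ℝ) : ℂ))) := by
  have hinfty : Tendsto (fun l : ℝ => l⁻¹ • x) (𝓝[>] 0) (cocompact E) := by
    rw [← Metric.cobounded_eq_cocompact, ← tendsto_norm_atTop_iff_cobounded]
    simp only [norm_smul]
    exact (tendsto_norm_atTop_atTop.comp tendsto_inv_nhdsGT_zero).atTop_mul_const
      (norm_pos_iff.2 hx)
  have hequiv := (IsEquivalent.refl (u := fun l : ℝ => ((l ^ (-s) : ℝ) : ℂ)) (l := 𝓝[>] 0)).mul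
    (hG.comp_tendsto hinfty)
  refine hequiv.symm.tendsto_nhds (tendsto_const_nhds.congr' ?_)
  filter_upwards [self_mem_nhdsWithin] with l (hl : 0 < l)
  simp only [Pi.mul_apply, Function.comp_apply]
  rw [mul_left_comm, ← Complex.ofReal_mul, rpow_mul_norm_inv_smul_rpow hl]

variable [MeasurableSpace E] [BorelSpace E] {μ : Measure E} [μ.IsAddHaarMeasure]

theorem rpow_mul_integral_comp_smul_eq {l : ℝ} (hl : 0 < l) :
    ((l ^ (finrank ℝ E - s) : ℝ) : ℂ) * ∫ y, G y * h (l • y) ∂μ =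
      ∫ x, ((l ^ (-s) : ℝ) : ℂ) * G (l⁻¹ • x) * h x ∂μ := by
  have hsubst := Measure.integral_comp_smul_of_nonneg μ (fun x => G (l⁻¹ • x) * h x) (hR := hl.le) l
  simp only [inv_smul_smul₀ hl.ne'] at hsubst
  have hpow : l ^ (finrank ℝ E - s) * (l ^ finrank ℝ E)⁻¹ = l ^ (-s) := by
    rw [← Real.rpow_natCast, ← Real.rpow_neg hl.le, ← Real.rpow_add hl]
    congr 1
    ring
  rw [hsubst, Complex.real_smul, ← mul_assoc, ← Complex.ofReal_mul, hpow, ← integral_const_mul]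
  simp only [mul_assoc]

theorem tendsto_rpow_mul_integral_comp_smul_of_norm_le [Nontrivial E] {M : ℝ}
    (hG : G ~[cocompact E] fun y => c * ((‖y‖ ^ (-s) : ℝ) : ℂ)) (hGmeas : AEStronglyMeasurable G μ)
    (hbound : ∀ y, ‖G y‖ ≤ M * ‖y‖ ^ (-s)) (hh : AEStronglyMeasurable h μ)
    (hsh : Integrable (fun x => ((‖x‖ ^ (-s) : ℝ) : ℂ) * h x) μ) :
    Tendsto (fun l : ℝ => ((l ^ (finrank ℝ E - s) : ℝ) : ℂ) * ∫ y, G y * h (l • y) ∂μ) (𝓝[>] 0)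
      (𝓝 (c * ∫ x, ((‖x‖ ^ (-s) : ℝ) : ℂ) * h x ∂μ)) := by
  rw [← integral_const_mul]
  simp only [← mul_assoc]
  refine Tendsto.congr' (eventually_nhdsWithin_of_forall fun l hl =>
    (rpow_mul_integral_comp_smul_eq hl).symm) ?_
  refine tendsto_integral_filter_of_dominated_convergence
    (fun x => M * ‖((‖x‖ ^ (-s) : ℝ) : ℂ) * h x‖) ?_ ?_ (hsh.norm.const_mul M) ?_
  · filter_upwards [self_mem_nhdsWithin] with l (hl : 0 < l)
    have := Measure.quasiMeasurePreserving_smul μ (inv_ne_zero hl.ne')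
    exact ((hGmeas.comp_quasiMeasurePreserving this).const_mul _).mul hh
  · filter_upwards [self_mem_nhdsWithin] with l (hl : 0 < l)
    refine ae_of_all _ fun x => ?_
    calc ‖((l ^ (-s) : ℝ) : ℂ) * G (l⁻¹ • x) * h x‖
        ≤ l ^ (-s) * (M * ‖l⁻¹ • x‖ ^ (-s)) * ‖h x‖ := by
          rw [norm_mul, norm_mul, Complex.norm_of_nonneg (by positivity)]
          gcongr
          exact hbound _
      _ = M * ‖((‖x‖ ^ (-s) : ℝ) : ℂ) * h x‖ := by
          rw [mul_left_comm, rpow_mul_norm_inv_smul_rpow hl, norm_mul,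
            Complex.norm_of_nonneg (by positivity), mul_assoc]
  · filter_upwards [μ.ae_ne 0] with x hx
    exact (tendsto_rpow_mul_comp_inv_smul hG hx).mul_const (h x)

theorem integrable_mul_comp_smul {B : ℝ} (hG : LocallyIntegrable G μ)
    (hGfar : G =O[cocompact E] (fun _ => 1 : E → ℝ)) (hh : Integrable h μ) (hB : ∀ x, ‖h x‖ ≤ B)
    {l : ℝ} (hl : l ≠ 0) :
    Integrable (fun y => G y * h (l • y)) μ := by
  obtain ⟨M, R, -, -, hM⟩ := exists_norm_le_mul_of_isBigO hGfar
  have hhl : Integrable (fun y => h (l • y)) μ := (integrable_comp_smul_iff μ h hl).2 hh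
  rw [← integrableOn_univ, ← Set.union_compl_self (Metric.ball (0 : E) R)]
  refine IntegrableOn.union ?_ ?_
  · exact (integrableOn_ball_of_locallyIntegrable hG 0 R).mul_bdd
      hhl.aestronglyMeasurable.restrict (ae_of_all _ fun y => hB _)
  · refine hhl.integrableOn.bdd_mul hG.aestronglyMeasurable.restrict ?_ (c := M)
    filter_upwards [ae_restrict_mem measurableSet_ball.compl] with y hy
    simpa only [norm_one, mul_one] using hM y (by simpa using hy)

theorem tendsto_rpow_mul_integral_comp_smul [Nontrivial E] {B K δ : ℝ}
    (hGloc : LocallyIntegrable G μ)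
    (hG : G ~[cocompact E] fun y => c * ((‖y‖ ^ (-s) : ℝ) : ℂ)) (hh : Integrable h μ)
    (hB : ∀ x, ‖h x‖ ≤ B) (hK : ∀ x, ‖h x‖ ≤ K * ‖x‖ ^ δ) (hδ : 0 ≤ δ) (hs : 0 ≤ s)
    (hsδ : s < finrank ℝ E + δ) :
    Tendsto (fun l : ℝ => ((l ^ (finrank ℝ E - s) : ℝ) : ℂ) * ∫ y, G y * h (l • y) ∂μ) (𝓝[>] 0)
      (𝓝 (c * ∫ x, ((‖x‖ ^ (-s) : ℝ) : ℂ) * h x ∂μ)) := by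
  obtain ⟨M, R, hM, hR, hfar⟩ :=
    exists_norm_le_mul_of_isBigO (isBigO_rpow_of_isEquivalent hG)
  set b := Metric.ball (0 : E) R
  have htail_equiv : bᶜ.indicator G ~[cocompact E] fun y => c * ((‖y‖ ^ (-s) : ℝ) : ℂ) := by
    refine hG.congr_left ?_
    rw [← Metric.cobounded_eq_cocompact]
    filter_upwards [eventually_cobounded_le_norm R] with y hy
    rw [Set.indicator_of_mem (by simpa [b] using hy)]
  have htail_le (y : E) : ‖bᶜ.indicator G y‖ ≤ M * ‖y‖ ^ (-s) := by
    by_cases hy : y ∈ bᶜ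
    · rw [Set.indicator_of_mem hy]
      simpa only [Real.norm_of_nonneg (Real.rpow_nonneg (norm_nonneg y) _)] using
        hfar y (by simpa [b] using hy)
    · rw [Set.indicator_of_notMem hy, norm_zero]
      positivity
  have hinner := tendsto_rpow_mul_setIntegral_ball_comp_smul (a := finrank ℝ E - s)
    hR (integrableOn_ball_of_locallyIntegrable hGloc 0 R) hK hδ (by linarith)
  have houter := tendsto_rpow_mul_integral_comp_smul_of_norm_le htail_equiv
    (hGloc.aestronglyMeasurable.indicator measurableSet_ball.compl) htail_le
    hh.aestronglyMeasurable (integrable_norm_rpow_mul hh hK hs hsδ)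
  rw [← zero_add (c * _)]
  refine (hinner.add houter).congr' ?_
  filter_upwards [self_mem_nhdsWithin] with l (hl : 0 < l)
  have hint := integrable_mul_comp_smul hGloc (isBigO_one_of_isEquivalent hG hs) hh hB hl.ne'
  rw [← integral_add_compl (s := b) measurableSet_ball hint, mul_add]
  congr 2
  rw [← integral_indicator (s := bᶜ) measurableSet_ball.compl]
  simp only [Set.indicator_mul_left]

end Scaling

/-- The power `y ↦ ‖y‖ ^ a` cut off to `0` on the open unit ball: a locally integrable function with
the same behaviour at infinity as `‖y‖ ^ a`, whatever the exponent. -/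
noncomputable def cutoffNormRpow {E : Type*} [NormedAddCommGroup E] (a : ℝ) (y : E) : ℝ :=
  (Set.Ici 1).indicator (fun t : ℝ => t ^ a) ‖y‖

theorem cutoffNormRpow_nonneg {E : Type*} [NormedAddCommGroup E] (a : ℝ) (y : E) :
    0 ≤ cutoffNormRpow a y :=
  Set.indicator_nonneg (fun _ ht => Real.rpow_nonneg (zero_le_one.trans ht) _) _

theorem cutoffNormRpow_of_one_le {E : Type*} [NormedAddCommGroup E] {a : ℝ} {y : E}
    (hy : 1 ≤ ‖y‖) : cutoffNormRpow a y = ‖y‖ ^ a :=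
  Set.indicator_of_mem (Set.mem_Ici.2 hy) _

theorem cutoffNormRpow_eventuallyEq {E : Type*} [NormedAddCommGroup E] [ProperSpace E] (a : ℝ) :
    cutoffNormRpow a =ᶠ[cocompact E] fun y => ‖y‖ ^ a := by
  rw [← Metric.cobounded_eq_cocompact]
  exact (eventually_cobounded_le_norm 1).mono fun y hy => cutoffNormRpow_of_one_le hy

theorem locallyIntegrable_cutoffNormRpow {E : Type*} [NormedAddCommGroup E] [MeasurableSpace E]
    [BorelSpace E] {μ : Measure E} [IsLocallyFiniteMeasure μ] {a : ℝ} (ha : a ≤ 0) :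
    LocallyIntegrable (cutoffNormRpow a : E → ℝ) μ := by
  have hmeas : Measurable (cutoffNormRpow a : E → ℝ) :=
    (Measurable.indicator (by fun_prop) measurableSet_Ici).comp measurable_norm
  refine (locallyIntegrable_const (1 : ℝ)).mono hmeas.aestronglyMeasurable (ae_of_all _ fun y => ?_)
  rw [norm_one, Real.norm_of_nonneg (cutoffNormRpow_nonneg a y)]
  exact Set.indicator_le' (fun t ht => Real.rpow_le_one_of_one_le_of_nonpos ht ha)
    (fun _ _ => zero_le_one) _

theorem finrank_mul_measureReal_ball_pos {E : Type*} [NormedAddCommGroup E] [NormedSpace ℝ E]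
    [FiniteDimensional ℝ E] [Nontrivial E] [MeasurableSpace E] {μ : Measure E}
    [μ.IsOpenPosMeasure] [IsFiniteMeasureOnCompacts μ] :
    0 < finrank ℝ E * μ.real (Metric.ball (0 : E) 1) :=
  mul_pos (Nat.cast_pos.2 (finrank_pos (R := ℝ) (M := E)))
    (ENNReal.toReal_pos (Metric.measure_ball_pos μ 0 one_pos).ne' measure_ball_lt_top.ne)

section LogGrowth

variable {E : Type*} [NormedAddCommGroup E] [NormedSpace ℝ E] [FiniteDimensional ℝ E]
  [MeasurableSpace E] [BorelSpace E] {μ : Measure E}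

theorem isLittleO_setIntegral_ball {f : E → ℂ} {q : E → ℝ} (hf : LocallyIntegrable f μ)
    (hq : LocallyIntegrable q μ) (hq0 : 0 ≤ q) (hfq : f =o[cocompact E] q)
    (hqtop : Tendsto (fun r : ℝ => ∫ y in Metric.ball 0 r, q y ∂μ) atTop atTop) :
    (fun r : ℝ => ∫ y in Metric.ball 0 r, f y ∂μ) =o[atTop]
      fun r : ℝ => ∫ y in Metric.ball 0 r, q y ∂μ := by
  have hfball (r : ℝ) := integrableOn_ball_of_locallyIntegrable hf 0 r
  have hqball (r : ℝ) := integrableOn_ball_of_locallyIntegrable hq 0 r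
  refine isLittleO_iff.2 fun η hη => ?_
  have hsmall := isLittleO_iff.1 hfq (half_pos hη)
  rw [← Metric.cobounded_eq_cocompact, hasBasis_cobounded_norm.eventually_iff] at hsmall
  obtain ⟨R, -, hR⟩ := hsmall
  set A := ∫ y in Metric.ball 0 R, ‖f y‖ ∂μ
  filter_upwards [eventually_ge_atTop R, hqtop.eventually_ge_atTop (A / (η / 2))] with r hr hAr
  have hpointwise (y : E) :
      ‖f y‖ ≤ (Metric.ball 0 R).indicator (fun y => ‖f y‖) y + η / 2 * q y := by
    have : 0 ≤ η / 2 * q y := mul_nonneg (half_pos hη).le (hq0 y)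
    by_cases hy : y ∈ Metric.ball 0 R
    · rwa [Set.indicator_of_mem hy, le_add_iff_nonneg_right]
    · rw [Set.indicator_of_notMem hy, zero_add, ← Real.norm_of_nonneg (hq0 y)]
      exact hR (show R ≤ ‖y‖ by simpa using hy)
  have hnear : IntegrableOn ((Metric.ball 0 R).indicator fun y => ‖f y‖) (Metric.ball 0 r) μ :=
    (hfball r).norm.indicator measurableSet_ball
  have hA : ∫ y in Metric.ball 0 r, (Metric.ball 0 R).indicator (fun y => ‖f y‖) y ∂μ = A := by
    rw [setIntegral_indicator measurableSet_ball,
      Set.inter_eq_self_of_subset_right (Metric.ball_subset_ball hr)]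
  calc ‖∫ y in Metric.ball 0 r, f y ∂μ‖
      ≤ A + η / 2 * ∫ y in Metric.ball 0 r, q y ∂μ := by
        rw [← hA, ← integral_const_mul, ← integral_add hnear ((hqball r).const_mul _)]
        exact norm_integral_le_of_norm_le (hnear.add ((hqball r).const_mul _))
          (ae_of_all _ hpointwise)
    _ ≤ η * ‖∫ y in Metric.ball 0 r, q y ∂μ‖ := by
        rw [Real.norm_of_nonneg (integral_nonneg hq0)]
        linarith [(div_le_iff₀ (half_pos hη)).1 hAr]

variable [Nontrivial E] [μ.IsAddHaarMeasure]

theorem setIntegral_ball_cutoffNormRpow_neg_finrank {r : ℝ} (hr : 1 ≤ r) :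
    ∫ y in Metric.ball (0 : E) r, cutoffNormRpow (-finrank ℝ E) y ∂μ =
      finrank ℝ E * μ.real (Metric.ball 0 1) * Real.log r := by
  have hradial (y : E) : (Metric.ball 0 r).indicator
      (cutoffNormRpow (-finrank ℝ E)) y =
        (Set.Ico 1 r).indicator (fun t : ℝ => t ^ (-finrank ℝ E : ℝ)) ‖y‖ := by
    simp only [cutoffNormRpow, Set.indicator, mem_ball_zero_iff, Set.mem_Ici, Set.mem_Ico]
    grind
  have hcancel {t : ℝ} (ht : 0 < t) :
      t ^ (finrank ℝ E - 1) * t ^ (-finrank ℝ E : ℝ) = t⁻¹ := by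
    rw [← Real.rpow_natCast, ← Real.rpow_add ht,
      Nat.cast_pred (finrank_pos (R := ℝ) (M := E)), ← Real.rpow_neg_one]
    congr 1
    ring
  have hIco : Set.Ico 1 r ⊆ Set.Ioi 0 := fun t ht => zero_lt_one.trans_le ht.1
  have hlog : ∫ t in Set.Ioi (0 : ℝ), t ^ (finrank ℝ E - 1) •
      (Set.Ico 1 r).indicator (fun t : ℝ => t ^ (-finrank ℝ E : ℝ)) t = Real.log r := by
    calc _ = ∫ t in Set.Ioi (0 : ℝ), (Set.Ico 1 r).indicator (fun t : ℝ => t⁻¹) t := by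
          refine setIntegral_congr_fun measurableSet_Ioi fun t (ht : 0 < t) => ?_
          simp only [Set.indicator, smul_eq_mul, mul_ite, mul_zero, hcancel ht]
      _ = ∫ t in (1 : ℝ)..r, t⁻¹ := by
          rw [setIntegral_indicator measurableSet_Ico, Set.inter_eq_self_of_subset_right hIco,
            integral_Ico_eq_integral_Ioo, ← integral_Ioc_eq_integral_Ioo,
            ← intervalIntegral.integral_of_le hr]
      _ = Real.log r := by
          rw [integral_inv_of_pos one_pos (one_pos.trans_le hr), div_one]
  rw [← integral_indicator measurableSet_ball]
  simp only [hradial]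
  rw [integral_fun_norm_addHaar μ, hlog, nsmul_eq_mul, smul_eq_mul]
  ring

theorem isLittleO_setIntegral_ball_log {f : E → ℂ} (hf : LocallyIntegrable f μ)
    (hfd : f =o[cocompact E] fun y => ‖y‖ ^ (-finrank ℝ E : ℝ)) :
    (fun r : ℝ => ∫ y in Metric.ball 0 r, f y ∂μ) =o[atTop] Real.log := by
  set q : E → ℝ := cutoffNormRpow (-finrank ℝ E)
  set σ : ℝ := finrank ℝ E * μ.real (Metric.ball (0 : E) 1)
  have hσ : 0 < σ := finrank_mul_measureReal_ball_pos
  have hqlog : (fun r : ℝ => ∫ y in Metric.ball (0 : E) r, q y ∂μ) =ᶠ[atTop]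
      fun r => σ * Real.log r :=
    (eventually_ge_atTop 1).mono fun r hr => setIntegral_ball_cutoffNormRpow_neg_finrank hr
  have hqtop : Tendsto (fun r : ℝ => ∫ y in Metric.ball (0 : E) r, q y ∂μ) atTop atTop :=
    (Real.tendsto_log_atTop.const_mul_atTop hσ).congr' hqlog.symm
  have hball := isLittleO_setIntegral_ball hf
    (locallyIntegrable_cutoffNormRpow (neg_nonpos.2 (Nat.cast_nonneg _)))
    (cutoffNormRpow_nonneg _) (hfd.congr' .rfl (cutoffNormRpow_eventuallyEq _).symm) hqtop
  exact (hball.congr' .rfl hqlog).trans_isBigO (isBigO_const_mul_self σ _ _)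

theorem tendsto_setIntegral_ball_div_log {G : E → ℂ} {c : ℂ} (hGloc : LocallyIntegrable G μ)
    (hG : G ~[cocompact E] fun y => c * ((‖y‖ ^ (-finrank ℝ E : ℝ) : ℝ) : ℂ)) :
    Tendsto (fun r : ℝ => (∫ y in Metric.ball (0 : E) r, G y ∂μ) / ((Real.log r : ℝ) : ℂ)) atTop
      (𝓝 (c * ((finrank ℝ E * μ.real (Metric.ball (0 : E) 1) : ℝ) : ℂ))) := by
  set σ : ℝ := finrank ℝ E * μ.real (Metric.ball (0 : E) 1)
  set q : E → ℝ := cutoffNormRpow (-finrank ℝ E)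
  have hcqloc : LocallyIntegrable (fun y => c * (q y : ℂ)) μ := fun x =>
    let ⟨s, hs, hq⟩ := locallyIntegrable_cutoffNormRpow (neg_nonpos.2 (Nat.cast_nonneg _)) x
    ⟨s, hs, hq.ofReal.const_mul c⟩
  have hdiff : (fun y => G y - c * (q y : ℂ)) =o[cocompact E]
      fun y => ‖y‖ ^ (-finrank ℝ E : ℝ) := by
    have hGq : G - (fun y => c * ((‖y‖ ^ (-finrank ℝ E : ℝ) : ℝ) : ℂ)) =ᶠ[cocompact E]
        fun y => G y - c * (q y : ℂ) :=
      (cutoffNormRpow_eventuallyEq (-finrank ℝ E : ℝ)).mono fun y hy => by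
        simp only [Pi.sub_apply, q, hy]
    exact (hG.isLittleO.congr' hGq .rfl).trans_isBigO
      ((Complex.isBigO_ofReal_left.2 (isBigO_refl _ _)).const_mul_left c)
  have hball := (Complex.isLittleO_ofReal_right.2
    (isLittleO_setIntegral_ball_log (hGloc.sub hcqloc) hdiff)).tendsto_div_nhds_zero
  rw [← zero_add (c * (σ : ℂ))]
  refine (hball.add_const (c * (σ : ℂ))).congr' ?_
  filter_upwards [eventually_gt_atTop 1] with r hr
  have hlog : ((Real.log r : ℝ) : ℂ) ≠ 0 := Complex.ofReal_ne_zero.2 (Real.log_pos hr).ne'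
  have hq : ∫ y in Metric.ball (0 : E) r, q y ∂μ = σ * Real.log r :=
    setIntegral_ball_cutoffNormRpow_neg_finrank hr.le
  simp only [Pi.sub_apply]
  rw [integral_sub (integrableOn_ball_of_locallyIntegrable hGloc 0 r)
    (integrableOn_ball_of_locallyIntegrable hcqloc 0 r), integral_const_mul,
    integral_complex_ofReal, hq, Complex.ofReal_mul, sub_div, ← mul_assoc,
    mul_div_cancel_right₀ _ hlog, sub_add_cancel]

end LogGrowth

section Subtraction

variable {E : Type*} [NormedAddCommGroup E]

/-- `h` minus its value at `0` on the open unit ball: it vanishes at `0`, so that it can be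
integrated against the non-integrable power `‖x‖ ^ (-d)` in dimension `d`. -/
noncomputable def subtractAtZero (h : E → ℂ) : E → ℂ :=
  h - (Metric.ball 0 1).indicator fun _ => h 0

theorem subtractAtZero_eq_self {h : E → ℂ} (h0 : h 0 = 0) : subtractAtZero h = h := by
  rw [subtractAtZero, h0, Set.indicator_zero, Pi.zero_def.symm, sub_zero]

theorem norm_subtractAtZero_le {h : E → ℂ} {B : ℝ} (hB : ∀ x, ‖h x‖ ≤ B) (x : E) :
    ‖subtractAtZero h x‖ ≤ B + B :=
  (norm_sub_le _ _).trans (add_le_add (hB x) ((norm_indicator_le_norm_self _ x).trans (hB 0)))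

theorem norm_subtractAtZero_le_mul_norm {h : E → ℂ} {B K : ℝ} (hB : ∀ x, ‖h x‖ ≤ B)
    (hK : ∀ x, ‖h x - h 0‖ ≤ K * ‖x‖) (x : E) : ‖subtractAtZero h x‖ ≤ (K + B) * ‖x‖ := by
  have hB0 : 0 ≤ B := (norm_nonneg _).trans (hB 0)
  rw [add_mul, subtractAtZero, Pi.sub_apply]
  by_cases hx : x ∈ Metric.ball (0 : E) 1
  · rw [Set.indicator_of_mem hx]
    linarith [hK x, mul_nonneg hB0 (norm_nonneg x)]
  · rw [Set.indicator_of_notMem hx, sub_zero]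
    have hKx : 0 ≤ K * ‖x‖ := (norm_nonneg _).trans (hK x)
    have hx1 : 1 ≤ ‖x‖ := by simpa using hx
    linarith [hB x, le_mul_of_one_le_right hB0 hx1]

theorem integrable_subtractAtZero [ProperSpace E] [MeasurableSpace E] [OpensMeasurableSpace E]
    {μ : Measure E} [IsFiniteMeasureOnCompacts μ] {h : E → ℂ} (hh : Integrable h μ) :
    Integrable (subtractAtZero h) μ :=
  hh.sub ((integrable_indicator_iff measurableSet_ball).2
    (integrableOn_const measure_ball_lt_top.ne))

theorem comp_smul_eq_subtractAtZero_add [NormedSpace ℝ E] (h : E → ℂ) {l : ℝ} (hl : 0 < l)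
    (y : E) : h (l • y) =
      subtractAtZero h (l • y) + (Metric.ball 0 l⁻¹).indicator (fun _ => h 0) y := by
  have hball : l • y ∈ Metric.ball (0 : E) 1 ↔ y ∈ Metric.ball (0 : E) l⁻¹ := by
    rw [mem_ball_zero_iff, mem_ball_zero_iff, norm_smul, Real.norm_of_nonneg hl.le,
      inv_eq_one_div, lt_div_iff₀' hl]
  rw [subtractAtZero, Pi.sub_apply]
  by_cases hy : y ∈ Metric.ball (0 : E) l⁻¹
  · rw [Set.indicator_of_mem hy, Set.indicator_of_mem (hball.2 hy), sub_add_cancel]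
  · rw [Set.indicator_of_notMem hy, Set.indicator_of_notMem (mt hball.1 hy), sub_zero, add_zero]

variable [NormedSpace ℝ E] [FiniteDimensional ℝ E] [Nontrivial E] [MeasurableSpace E]
  [BorelSpace E] {μ : Measure E} [μ.IsAddHaarMeasure] {G h : E → ℂ} {c : ℂ} {B K : ℝ}

theorem tendsto_integral_subtractAtZero_comp_smul (hGloc : LocallyIntegrable G μ)
    (hG : G ~[cocompact E] fun y => c * ((‖y‖ ^ (-finrank ℝ E : ℝ) : ℝ) : ℂ))
    (hh : Integrable h μ) (hB : ∀ x, ‖h x‖ ≤ B) (hK : ∀ x, ‖h x - h 0‖ ≤ K * ‖x‖) :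
    Tendsto (fun l : ℝ => ∫ y, G y * subtractAtZero h (l • y) ∂μ) (𝓝[>] 0)
      (𝓝 (c * ∫ x, ((‖x‖ ^ (-finrank ℝ E : ℝ) : ℝ) : ℂ) * subtractAtZero h x ∂μ)) := by
  have := tendsto_rpow_mul_integral_comp_smul (δ := 1) hGloc hG (integrable_subtractAtZero hh)
    (norm_subtractAtZero_le hB)
    (by simpa only [Real.rpow_one] using norm_subtractAtZero_le_mul_norm hB hK) zero_le_one
    (Nat.cast_nonneg _) (by linarith)
  simpa only [sub_self, Real.rpow_zero, Complex.ofReal_one, one_mul] using this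

theorem tendsto_integral_comp_smul_div_log (hGloc : LocallyIntegrable G μ)
    (hG : G ~[cocompact E] fun y => c * ((‖y‖ ^ (-finrank ℝ E : ℝ) : ℝ) : ℂ))
    (hh : Integrable h μ) (hB : ∀ x, ‖h x‖ ≤ B) (hK : ∀ x, ‖h x - h 0‖ ≤ K * ‖x‖) :
    Tendsto (fun l : ℝ => (∫ y, G y * h (l • y) ∂μ) / ((Real.log (1 / l) : ℝ) : ℂ)) (𝓝[>] 0)
      (𝓝 (c * ((finrank ℝ E * μ.real (Metric.ball (0 : E) 1) : ℝ) : ℂ) * h 0)) := by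
  have hlog : Tendsto (fun l : ℝ => ((Real.log l⁻¹ : ℝ) : ℂ)⁻¹) (𝓝[>] 0) (𝓝 0) := by
    have := tendsto_inv_atTop_zero.comp (Real.tendsto_log_atTop.comp tendsto_inv_nhdsGT_zero)
    simpa only [Function.comp_def, Complex.ofReal_inv, Complex.ofReal_zero] using this.ofReal
  have hsubtracted := (tendsto_integral_subtractAtZero_comp_smul hGloc hG hh hB hK).mul hlog
  have hball := ((tendsto_setIntegral_ball_div_log hGloc hG).comp
    tendsto_inv_nhdsGT_zero).mul_const (h 0)
  have hsum := hsubtracted.add hball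
  rw [mul_zero, zero_add] at hsum
  refine hsum.congr' ?_
  have hGfar := isBigO_one_of_isEquivalent hG (Nat.cast_nonneg _)
  filter_upwards [self_mem_nhdsWithin] with l (hl : 0 < l)
  have hsplit : ∫ y, G y * h (l • y) ∂μ = (∫ y, G y * subtractAtZero h (l • y) ∂μ) +
      (∫ y in Metric.ball 0 l⁻¹, G y ∂μ) * h 0 := by
    rw [← integral_mul_const, ← integral_indicator measurableSet_ball, ← integral_add
      (integrable_mul_comp_smul hGloc hGfar (integrable_subtractAtZero hh)
        (norm_subtractAtZero_le hB) hl.ne')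
      ((integrable_indicator_iff measurableSet_ball).2
        ((integrableOn_ball_of_locallyIntegrable hGloc 0 l⁻¹).mul_const (h 0)))]
    simp only [comp_smul_eq_subtractAtZero_add h hl, mul_add, Set.indicator, mul_ite, mul_zero]
  rw [hsplit, Function.comp_apply, one_div, add_div, ← div_eq_mul_inv, div_mul_eq_mul_div]

end Subtraction

section Schwartz

variable {E : Type*} [NormedAddCommGroup E] [NormedSpace ℝ E]

theorem exists_norm_sub_apply_zero_le (f : 𝓢(E, ℂ)) : ∃ K, ∀ x, ‖f x - f 0‖ ≤ K * ‖x‖ := by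
  refine ⟨SchwartzMap.seminorm ℝ 0 1 f, fun x => ?_⟩
  have := convex_univ.norm_image_sub_le_of_norm_fderiv_le (𝕜 := ℝ) (f := f)
    (fun y _ => f.differentiableAt)
    (fun y _ => by simpa using SchwartzMap.le_seminorm ℝ 0 1 f y) (Set.mem_univ 0) (Set.mem_univ x)
  rwa [sub_zero] at this

theorem integrable_log_norm_mul_schwartz [FiniteDimensional ℝ E] [Nontrivial E]
    [MeasurableSpace E] [BorelSpace E] {μ : Measure E} [μ.IsAddHaarMeasure] (f : 𝓢(E, ℂ)) :
    Integrable (fun x => ((Real.log ‖x‖ : ℝ) : ℂ) * f x) μ :=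
  integrable_log_norm_mul f.continuous.aestronglyMeasurable (f.norm_le_seminorm ℝ)
    (by simpa only [pow_one] using f.integrable_pow_mul μ 1)

theorem integrable_norm_rpow_mul_schwartz [FiniteDimensional ℝ E] [Nontrivial E]
    [MeasurableSpace E] [BorelSpace E] {μ : Measure E} [μ.IsAddHaarMeasure] (f : 𝓢(E, ℂ)) {a : ℝ}
    (ha : 0 ≤ a) (had : a < finrank ℝ E) :
    Integrable (fun x => ((‖x‖ ^ (-a) : ℝ) : ℂ) * f x) μ :=
  integrable_norm_rpow_mul (δ := 0) f.integrable
    (by simpa only [Real.rpow_zero, mul_one] using f.norm_le_seminorm ℝ) ha (by rwa [add_zero])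

end Schwartz

section SchwartzFourier

variable {E : Type*} [NormedAddCommGroup E] [InnerProductSpace ℝ E] [FiniteDimensional ℝ E]
  [MeasurableSpace E] [BorelSpace E]

theorem fourier_apply_zero (f : 𝓢(E, ℂ)) : 𝓕 f 0 = ∫ p, f p := by
  rw [SchwartzMap.fourier_coe, Real.fourier_eq]
  simp only [inner_zero_right, neg_zero, AddChar.map_zero_eq_one, one_smul]

variable [Nontrivial E]

theorem integral_norm_rpow_mul_fourier_schwartz (f : 𝓢(E, ℂ)) {a b : ℝ} (ha : 0 < a) (hb : 0 < b)
    (hab : a + b = finrank ℝ E) :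
    ∫ x, ((‖x‖ ^ (-a) : ℝ) : ℂ) * 𝓕 f x =
      Complex.Gammaℝ b / Complex.Gammaℝ a * ∫ p, ((‖p‖ ^ (-b) : ℝ) : ℂ) * f p := by
  have hΓ : Complex.Gammaℝ a ≠ 0 := Complex.Gammaℝ_ne_zero_of_re_pos (by simpa using ha)
  have hriesz := integral_norm_rpow_mul_fourier ha hb hab f.integrable
    (𝓕 f).continuous.aestronglyMeasurable
    (integrable_norm_rpow_mul_schwartz (𝓕 f) ha.le (by linarith))
    (integrable_norm_rpow_mul_schwartz f hb.le (by linarith))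
  rw [div_mul_eq_mul_div, eq_div_iff hΓ, mul_comm]
  exact hriesz

theorem integral_norm_rpow_neg_finrank_mul_fourier_schwartz (f : 𝓢(E, ℂ)) (hf0 : ∫ x, f x = 0) :
    ∫ x, ((‖x‖ ^ (-finrank ℝ E : ℝ) : ℝ) : ℂ) * 𝓕 f x =
      -((finrank ℝ E * volume.real (Metric.ball (0 : E) 1) : ℝ) : ℂ) *
        ∫ p, ((Real.log ‖p‖ : ℝ) : ℂ) * f p := by
  obtain ⟨K, hK⟩ := exists_norm_sub_apply_zero_le (𝓕 f)
  rw [fourier_apply_zero, hf0] at hK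
  have hint : Integrable fun x => ((‖x‖ ^ (-finrank ℝ E : ℝ) : ℝ) : ℂ) * 𝓕 f x :=
    integrable_norm_rpow_mul (δ := 1) (𝓕 f).integrable
      (by simpa only [sub_zero, Real.rpow_one] using hK) (Nat.cast_nonneg _) (by linarith)
  have hlog := integral_norm_rpow_neg_finrank_mul_fourier f.integrable hf0
    (𝓕 f).continuous.aestronglyMeasurable hint (integrable_log_norm_mul_schwartz f)
  have hΓ : Complex.Gammaℝ (finrank ℝ E) ≠ 0 :=
    left_ne_zero_of_mul (gammaℝ_finrank_mul_volume_ball (E := E) ▸ two_ne_zero)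
  refine mul_left_cancel₀ hΓ ?_
  rw [← mul_assoc, mul_neg, gammaℝ_finrank_mul_volume_ball]
  exact hlog

end SchwartzFourier

section Representation

variable {n : ℕ} {g g₁ g₂ : EuclideanSpace ℝ (Fin n) → ℂ}

theorem isRepresentedBy_add {T₁ T₂ : 𝓢'(EuclideanSpace ℝ (Fin n), ℂ)} (h₁ : IsRepresentedBy T₁ g₁)
    (h₂ : IsRepresentedBy T₂ g₂) : IsRepresentedBy (T₁ + T₂) (g₁ + g₂) := fun φ => by
  simp only [Pi.add_apply, add_mul]
  refine ⟨(h₁ φ).1.add (h₂ φ).1, ?_⟩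
  rw [integral_add (h₁ φ).1 (h₂ φ).1, ← (h₁ φ).2, ← (h₂ φ).2]
  rfl

theorem exists_isRepresentedBy_of_memLp {p : ENNReal} (hp : 1 ≤ p) (hg : MemLp g p) :
    ∃ T : 𝓢'(EuclideanSpace ℝ (Fin n), ℂ), IsRepresentedBy T g := by
  have : Fact (1 ≤ p) := ⟨hp⟩
  refine ⟨Lp.toTemperedDistribution hg.toLp, fun φ => ⟨?_, ?_⟩⟩
  · have := ENNReal.HolderConjugate.conjExponent hp
    exact hg.integrable_mul (φ.memLp p.conjExponent)
  · rw [Lp.toTemperedDistribution_apply]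
    refine integral_congr_ae ?_
    filter_upwards [hg.coeFn_toLp] with y hy
    rw [hy, smul_eq_mul, mul_comm]

theorem exists_isRepresentedBy_of_isBigO_one (hg : LocallyIntegrable g)
    (hfar : g =O[cocompact (EuclideanSpace ℝ (Fin n))] (fun _ => 1 : _ → ℝ)) :
    ∃ T : 𝓢'(EuclideanSpace ℝ (Fin n), ℂ), IsRepresentedBy T g := by
  obtain ⟨M, R, -, -, hM⟩ := exists_norm_le_mul_of_isBigO hfar
  set b := Metric.ball (0 : EuclideanSpace ℝ (Fin n)) R
  have hnear : MemLp (b.indicator g) 1 :=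
    memLp_one_iff_integrable.2 ((integrable_indicator_iff measurableSet_ball).2
      (integrableOn_ball_of_locallyIntegrable hg 0 R))
  have hfar : MemLp (bᶜ.indicator g) ⊤ := by
    refine memLp_top_of_bound (hg.aestronglyMeasurable.indicator measurableSet_ball.compl) (max M 0)
      (ae_of_all _ fun y => ?_)
    by_cases hy : y ∈ bᶜ
    · rw [Set.indicator_of_mem hy]
      have hMy := hM y (by simpa [b] using hy)
      rw [norm_one, mul_one] at hMy
      exact hMy.trans (le_max_left M 0)
    · rw [Set.indicator_of_notMem hy, norm_zero]
      exact le_max_right M 0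
  obtain ⟨T₁, hT₁⟩ := exists_isRepresentedBy_of_memLp le_rfl hnear
  obtain ⟨T₂, hT₂⟩ := exists_isRepresentedBy_of_memLp le_top hfar
  exact ⟨T₁ + T₂, Set.indicator_self_add_compl b g ▸ isRepresentedBy_add hT₁ hT₂⟩

theorem fourier_stretch_apply {l : ℝ} (hl : 0 < l) (φ : 𝓢(EuclideanSpace ℝ (Fin n), ℂ))
    (y : EuclideanSpace ℝ (Fin n)) :
    𝓕 (stretch l φ) y = ((l ^ n : ℝ) : ℂ) * 𝓕 φ (l • y) := by
  have hsubst := Measure.integral_comp_inv_smul_of_nonneg volume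
    (fun p => Real.fourierChar (-inner ℝ p (l • y)) • φ p) hl.le
  rw [finrank_euclideanSpace_fin] at hsubst
  rw [SchwartzMap.fourier_coe, SchwartzMap.fourier_coe, Real.fourier_eq, Real.fourier_eq,
    ← Complex.real_smul, ← hsubst]
  refine integral_congr_ae (ae_of_all _ fun p => ?_)
  simp only [stretch_apply hl.ne', inner_smul_left, inner_smul_right, map_inv₀, conj_trivial,
    mul_inv_cancel_left₀ hl.ne']

theorem rescaled_fourier {T : 𝓢'(EuclideanSpace ℝ (Fin n), ℂ)} (hT : IsRepresentedBy T g) {l : ℝ}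
    (hl : 0 < l) (φ : 𝓢(EuclideanSpace ℝ (Fin n), ℂ)) :
    rescaled (𝓕 T) l φ = ∫ y, g y * 𝓕 φ (l • y) := by
  have hln : ((l ^ n : ℝ) : ℂ) ≠ 0 := Complex.ofReal_ne_zero.2 (pow_pos hl n).ne'
  rw [rescaled, TemperedDistribution.fourier_apply, (hT _).2, ← integral_const_mul]
  refine integral_congr_ae (ae_of_all _ fun y => ?_)
  simp only [fourier_stretch_apply hl, Complex.ofReal_inv, mul_left_comm (g y),
    inv_mul_cancel_left₀ hln]

end Representation

section Singularities

variable {n : ℕ} {g : EuclideanSpace ℝ (Fin n) → ℂ} {T : 𝓢'(EuclideanSpace ℝ (Fin n), ℂ)}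

theorem hasPowerSingularity_fourier {ε : ℝ} (hε : 0 < ε) (hεn : ε < n)
    (hg : LocallyIntegrable g) (htail : HasPowerTail g (n - ε)) (hT : IsRepresentedBy T g) :
    HasPowerSingularity (𝓕 T) ε := by
  have : NeZero n := ⟨(Nat.cast_pos.1 (hε.trans hεn)).ne'⟩
  have hdim : (finrank ℝ (EuclideanSpace ℝ (Fin n)) : ℝ) = n := by
    rw [finrank_euclideanSpace_fin]
  have hs : 0 < n - ε := sub_pos.2 hεn
  obtain ⟨c, hc, hgc⟩ := htail
  refine ⟨c * (Complex.Gammaℝ ε / Complex.Gammaℝ (n - ε : ℝ)), mul_ne_zero hc (div_ne_zero ?_ ?_),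
    fun φ => ?_⟩
  · exact Complex.Gammaℝ_ne_zero_of_re_pos (by simpa using hε)
  · exact Complex.Gammaℝ_ne_zero_of_re_pos (by simpa using hs)
  have hlim := tendsto_rpow_mul_integral_comp_smul (δ := 0) hg hgc (𝓕 φ).integrable
    ((𝓕 φ).norm_le_seminorm ℝ)
    (by simpa only [Real.rpow_zero, mul_one] using (𝓕 φ).norm_le_seminorm ℝ) le_rfl hs.le
    (by rw [hdim]; linarith)
  rw [hdim, sub_sub_cancel, integral_norm_rpow_mul_fourier_schwartz φ hs hε (by rw [hdim]; ring),
    ← mul_assoc] at hlim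
  refine hlim.congr' ?_
  filter_upwards [self_mem_nhdsWithin] with l hl
  rw [rescaled_fourier hT hl]

theorem hasLogSingularity_fourier [NeZero n] (hg : LocallyIntegrable g) (htail : HasPowerTail g n)
    (hT : IsRepresentedBy T g) : HasLogSingularity (𝓕 T) := by
  obtain ⟨c, hc, hgc⟩ := htail
  set d : ℕ := finrank ℝ (EuclideanSpace ℝ (Fin n)) with hd
  have hgd : g ~[cocompact (EuclideanSpace ℝ (Fin n))] fun y =>
      c * ((‖y‖ ^ (-d : ℝ) : ℝ) : ℂ) := by
    simpa only [hd, finrank_euclideanSpace_fin] using hgc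
  set σ : ℝ := d * volume.real (Metric.ball (0 : EuclideanSpace ℝ (Fin n)) 1)
  have hσ : (σ : ℂ) ≠ 0 := Complex.ofReal_ne_zero.2 finrank_mul_measureReal_ball_pos.ne'
  refine ⟨c * σ, mul_ne_zero hc hσ, fun φ => ?_, fun φ hφ => ?_⟩
  all_goals obtain ⟨K, hK⟩ := exists_norm_sub_apply_zero_le (𝓕 φ)
  · have hlim := tendsto_integral_comp_smul_div_log hg hgd (𝓕 φ).integrable
      ((𝓕 φ).norm_le_seminorm ℝ) hK
    rw [fourier_apply_zero] at hlim
    refine hlim.congr' ?_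
    filter_upwards [self_mem_nhdsWithin] with l hl
    rw [rescaled_fourier hT hl]
  · have hlim := tendsto_integral_subtractAtZero_comp_smul hg hgd (𝓕 φ).integrable
      ((𝓕 φ).norm_le_seminorm ℝ) hK
    rw [subtractAtZero_eq_self ((fourier_apply_zero φ).trans hφ),
      integral_norm_rpow_neg_finrank_mul_fourier_schwartz φ hφ, ← mul_assoc, mul_neg] at hlim
    refine hlim.congr' ?_
    filter_upwards [self_mem_nhdsWithin] with l hl
    rw [rescaled_fourier hT hl]

end Singularities

theorem locallyIntegrable_dampedG {n : ℕ} {W : EuclideanSpace ℝ (Fin n) → ℂ} {β : ℝ}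
    (hβ : LocallyIntegrable (dampedG W β)) (α : ℝ) : LocallyIntegrable (dampedG W α) := by
  have hdamp : dampedG W α =
      fun y => dampedG W β y * (((1 + ‖y‖ ^ 2) ^ ((β - α) / 2) : ℝ) : ℂ) := by
    ext y
    rw [dampedG, dampedG, mul_assoc, ← Complex.ofReal_mul, ← Real.rpow_add (by positivity)]
    ring_nf
  rw [hdamp]
  exact hβ.mul_continuous <| Complex.continuous_ofReal.comp <|
    Continuous.rpow_const (by fun_prop) fun y => .inl (by positivity)

theorem mainTheorem3_general (n : ℕ) (g : EuclideanSpace ℝ (Fin n) → ℂ) (hg : LocallyIntegrable g)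
    (ε : ℝ) (hεn : ε < n) (htail : HasPowerTail g (n - ε)) :
    (0 < ε → ∃ T : 𝓢'(EuclideanSpace ℝ (Fin n), ℂ),
      IsRepresentedBy T g ∧ HasPowerSingularity (𝓕 T) ε) ∧
    (ε = 0 → ∃ T : 𝓢'(EuclideanSpace ℝ (Fin n), ℂ),
      IsRepresentedBy T g ∧ HasLogSingularity (𝓕 T)) := by
  have ⟨c, _, hgc⟩ := htail
  obtain ⟨T, hT⟩ := exists_isRepresentedBy_of_isBigO_one hg
    (isBigO_one_of_isEquivalent hgc (sub_pos.2 hεn).le)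
  refine ⟨fun hε => ⟨T, hT, hasPowerSingularity_fourier hε hεn hg htail hT⟩, ?_⟩
  rintro rfl
  have : NeZero n := ⟨(Nat.cast_pos.1 hεn).ne'⟩
  exact ⟨T, hT, hasLogSingularity_fourier hg (by rwa [sub_zero] at htail) hT⟩

theorem mainTheorem3 (n : ℕ) (W : EuclideanSpace ℝ (Fin n) → ℂ) (αinf : ℝ)
    (hinf : IsAlphaInf W αinf) (α ε : ℝ) (hε : αinf - α = ε) (hεn : ε < n)
    (htail : HasPowerTail (dampedG W α) (n - ε)) :
    (0 < ε → ∃ T : 𝓢'(EuclideanSpace ℝ (Fin n), ℂ),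
      IsRepresentedBy T (dampedG W α) ∧ HasPowerSingularity (𝓕 T) ε) ∧
    (α = αinf → ∃ T : 𝓢'(EuclideanSpace ℝ (Fin n), ℂ),
      IsRepresentedBy T (dampedG W α) ∧ HasLogSingularity (𝓕 T)) :=
  (mainTheorem3_general n _
    (locallyIntegrable_dampedG (hinf.1 _ (lt_add_one _)).locallyIntegrable α) ε hεn htail).imp_right
    fun h hα => h (by rw [← hε, hα, sub_self])
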